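/- Conventions. Let $L$ and $L'$ be first-order languages, let $T$ be a first-order $L$-theory, and let $\mathcal I$ be an $L'$-structure. Continuous logic is the logic of metric structures: nonempty complete metric spaces of diameter at most $1$ with functions and $[0,1]$-valued predicates respecting prescribed moduli of uniform continuity; its formulas are built from the metric and the predicates by all continuous connectives $[0,1]^l\to[0,1]$ and the quantifiers $\sup_x$, $\inf_x$; a continuous theory is a set of conditions $\varphi=0$ with $\varphi$ a sentence. Every nonempty first-order $L$-structure is regarded as a metric structure by giving it the discrete $\{0,1\}$-valued metric and letting each relation take the value $0$ where it holds and $1$ where it fails. Let $T'$ be a continuous logic counterpart of $T$, that is, a continuous theory in the symbols of $L$ whose models are exactly the models of $T$, regarded as metric structures. A monster model of a (classical or continuous) theory is a model $\mathfrak C$ that is $\kappa$-saturated and strongly $\kappa$-homogeneous for a strong limit cardinal $\kappa$ greater than $\aleph_0$ plus the number of symbols of the language. Sequences $(a_i : i\in\mathcal I)$ consist of $k$-tuples from $\mathfrak C$, for a fixed $k\in\mathbb N$ ($k=1$ gives sequences of elements), and $\mathfrak C$ is always taken with $|\mathcal I|<\kappa$. For $\bar i=(i_1,\dots,i_n)$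 write $a_{\bar i}=(a_{i_1},\dots,a_{i_n})$, and let $\mathrm{qftp}(\bar i)$ be the quantifier-free $L'$-type of $\bar i$ in $\mathcal I$. A sequence $(b_i)_{i\in \mathcal I}$ is $\mathcal I$-indiscernible if $\mathrm{qftp}(\bar i)=\mathrm{qftp}(\bar j)$ implies $\mathrm{tp}(b_{\bar i})=\mathrm{tp}(b_{\bar j})$ for all finite tuples $\bar i,\bar j$ of the same length (types being classical, respectively continuous). - $\mathcal I$ has the modeling property in $T$ if for every sequence $(a_i)_{i\in\mathcal I}$ in a monster model $\mathfrak C$ of $T$ there is an $\mathcal I$-indiscernible sequence $(b_i)_{i\in\mathcal I}$ in $\mathfrak C$ such that for every finite set $\Delta$ of $L$-formulas and every finite tuple $\bar j$ from $\mathcal I$ there is a tuple $\bar i$ from $\mathcal I$ with $\mathrm{qftp}(\bar i)=\mathrm{qftp}(\bar j)$ and $\mathrm{tp}^\Delta(b_{\bar j})=\mathrm{tp}^\Delta(a_{\bar i})$. - $\mathcal I$ has the continuous modeling property in $T'$ if for every sequence $(a_i)_{i\in\mathcal I}$ in a monster model $\mathfrak C$ of $T'$ there is an $\mathcal I$-indiscernible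 sequence $(b_i)_{i\in\mathcal I}$ in $\mathfrak C$ such that for every finite set $\Delta$ of continuous formulas, every finite tuple $\bar j$ from $\mathcal I$ and every $\varepsilon>0$ there is a tuple $\bar i$ from $\mathcal I$ with $\mathrm{qftp}(\bar i)=\mathrm{qftp}(\bar j)$ and $|\varphi(b_{\bar j})-\varphi(a_{\bar i})|\le\varepsilon$ for all $\varphi\in\Delta$. Proposition. For every $k$, $\mathcal I$ has the continuous modeling property in $T'$ (for sequences of $k$-tuples) if and only if $\mathcal I$ has the modeling property in $T$ (for sequences of $k$-tuples). -/

import Mathlib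

open FirstOrder Cardinal

universe u v u' v' w m

/-! ## Continuous (metric) logic -/

namespace ContLogic

/-- A modulus of uniform continuity: a map `δ : (0, ∞) → (0, ∞)` (values at `ε ≤ 0` are
irrelevant). -/
structure Modulus where
  toFun : ℝ → ℝ
  pos : ∀ ε, 0 < ε → 0 < toFun ε

set_option linter.checkUnivs false in
/-- A continuous (metric) signature: function symbols and predicate symbols with their arities, and
for each `n`-ary symbol and each `i < n` a continuity modulus. The distance symbol `d` is not listed
among the predicate symbols: it is always present, and is interpreted by the metric
(see `BFormula.dist`). -/
structure Signature extends FirstOrder.Language.{u, v} where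
  funModulus : ∀ {n : ℕ}, toLanguage.Functions n → Fin n → Modulus
  predModulus : ∀ {n : ℕ}, toLanguage.Relations n → Fin n → Modulus

/-- Structures for a continuous signature: nonempty complete metric spaces of diameter at most `1`,
where function symbols are interpreted by functions, and predicate symbols by `[0,1]`-valued
functions, that respect the prescribed continuity moduli in each argument. -/
structure MetricStructure (S : Signature.{u, v}) where
  Carrier : Type m
  [metric : MetricSpace Carrier]
  [complete : CompleteSpace Carrier]
  [nonempty : Nonempty Carrier]
  dist_le_one : ∀ x y : Carrier, dist x y ≤ 1
  funMap : ∀ {n : ℕ}, S.Functions n → (Fin n → Carrier) → Carrier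
  predMap : ∀ {n : ℕ}, S.Relations n → (Fin n → Carrier) → unitInterval
  fun_unif : ∀ {n : ℕ} (f : S.Functions n) (i : Fin n) (ε : ℝ), 0 < ε →
    ∀ (xs : Fin n → Carrier) (y : Carrier), dist (xs i) y < (S.funModulus f i).toFun ε →
      dist (funMap f xs) (funMap f (Function.update xs i y)) ≤ ε
  pred_unif : ∀ {n : ℕ} (P : S.Relations n) (i : Fin n) (ε : ℝ), 0 < ε →
    ∀ (xs : Fin n → Carrier) (y : Carrier), dist (xs i) y < (S.predModulus P i).toFun ε →
      |(predMap P xs : ℝ) - (predMap P (Function.update xs i y) : ℝ)| ≤ ε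

attribute [instance] MetricStructure.metric MetricStructure.complete MetricStructure.nonempty

instance (S : Signature.{u, v}) : CoeSort (MetricStructure.{u, v, m} S) (Type m) :=
  ⟨MetricStructure.Carrier⟩

/-- Formulas of continuous logic, with free variables indexed by `α` and `n` further variables
`0, …, n - 1` available for quantification. The connectives are all (automatically uniformly)
continuous functions `[0,1]^l → [0,1]`, `l < ω`. -/
inductive BFormula (S : Signature.{u, v}) (α : Type w) : ℕ → Type (max u v w)
  | dist {n : ℕ} (t₁ t₂ : S.toLanguage.Term (α ⊕ Fin n)) : BFormula S α n
  | pred {n l : ℕ} (P : S.Relations l) (ts : Fin l → S.toLanguage.Term (α ⊕ Fin n)) :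
      BFormula S α n
  | conn {n l : ℕ} (c : C(Fin l → unitInterval, unitInterval)) (φs : Fin l → BFormula S α n) :
      BFormula S α n
  | sup {n : ℕ} (φ : BFormula S α (n + 1)) : BFormula S α n
  | inf {n : ℕ} (φ : BFormula S α (n + 1)) : BFormula S α n

/-- Formulas with free variables indexed by `α`. -/
abbrev Formula (S : Signature.{u, v}) (α : Type w) : Type (max u v w) := BFormula S α 0

/-- Sentences. -/
abbrev Sentence (S : Signature.{u, v}) : Type (max u v) := Formula S Empty

/-- A continuous theory, given as a set of sentences: the sentence `φ` stands for the
condition `φ = 0`. -/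
abbrev Theory (S : Signature.{u, v}) : Type (max u v) := Set (Sentence S)

section Semantics

variable {S : Signature.{u, v}} (N : MetricStructure.{u, v, m} S) {α : Type w}

/-- The interpretation of a term under an assignment. -/
def termEval {β : Type w} (x : β → N) : S.toLanguage.Term β → N
  | .var b => x b
  | .func f ts => N.funMap f (fun i => termEval x (ts i))

/-- The value in `[0,1]` of a formula under an assignment. -/
noncomputable def bEval : ∀ {n : ℕ}, BFormula S α n → (α → N) → (Fin n → N) → unitInterval
  | _, .dist t₁ t₂, x, y =>
      ⟨Dist.dist (termEval N (Sum.elim x y) t₁) (termEval N (Sum.elim x y) t₂),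
        dist_nonneg, N.dist_le_one _ _⟩
  | _, .pred P ts, x, y => N.predMap P (fun i => termEval N (Sum.elim x y) (ts i))
  | _, .conn c φs, x, y => c (fun i => bEval (φs i) x y)
  | _, .sup φ, x, y => ⨆ z : N, bEval φ x (Fin.snoc y z)
  | _, .inf φ, x, y => ⨅ z : N, bEval φ x (Fin.snoc y z)

/-- The value `φ(x)` of a formula at a tuple. -/
noncomputable def eval (φ : Formula S α) (x : α → N) : unitInterval :=
  bEval N φ x Fin.elim0

/-- `N ⊨ T`: every condition `φ = 0` of `T` holds in `N`. -/
def Models (T : Theory S) : Prop := ∀ φ ∈ T, eval N φ (fun e : Empty => e.elim) = 0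

/-- Automorphisms: isometric bijections preserving all symbols. -/
def IsAutomorphism (g : N ≃ N) : Prop :=
  (∀ x y : N, dist (g x) (g y) = dist x y) ∧
  (∀ (n : ℕ) (f : S.Functions n) (x : Fin n → N), g (N.funMap f x) = N.funMap f (g ∘ x)) ∧
  (∀ (n : ℕ) (P : S.Relations n) (x : Fin n → N), N.predMap P (g ∘ x) = N.predMap P x)

/-- `κ`-saturation: every set of conditions `φ = 0` in finitely many variables, with fewer than `κ`
parameters, that is finitely satisfiable in `N` is satisfied in `N`. -/
def IsSaturated (κ : Cardinal.{m}) : Prop :=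
  ∀ (A : Set N), #A < κ → ∀ (l : ℕ) (Γ : Set (Formula S (A ⊕ Fin l))),
    (∀ Γ₀ : Set (Formula S (A ⊕ Fin l)), Γ₀ ⊆ Γ → Γ₀.Finite →
      ∃ x : Fin l → N, ∀ φ ∈ Γ₀, eval N φ (Sum.elim (fun a : A => (a : N)) x) = 0) →
    ∃ x : Fin l → N, ∀ φ ∈ Γ, eval N φ (Sum.elim (fun a : A => (a : N)) x) = 0

/-- Strong `κ`-homogeneity: every partial elementary map with domain of size less than `κ` extends
to an automorphism. -/
def IsStronglyHomogeneous (κ : Cardinal.{m}) : Prop :=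
  ∀ (A : Set N), #A < κ → ∀ f : A → N,
    (∀ φ : Formula S A, eval N φ f = eval N φ (fun a : A => (a : N))) →
    ∃ g : N ≃ N, IsAutomorphism N g ∧ ∀ a : A, g a = f a

/-- `N` is a monster model of `T` with respect to `κ`: a `κ`-saturated and strongly `κ`-homogeneous
model, where `κ` is a strong limit cardinal greater than `|T| = ℵ₀ + |S|`. -/
structure IsMonster (T : Theory S) (κ : Cardinal.{m}) : Prop where
  models : Models N T
  strongLimit : κ.IsStrongLimit
  card_lt : Cardinal.lift.{m} (max ℵ₀ S.card) < Cardinal.lift.{max u v} κ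
  saturated : IsSaturated N κ
  homogeneous : IsStronglyHomogeneous N κ

end Semantics

end ContLogic

/-! ## Monster models in classical logic -/

namespace ClassicalLogic

/-- `κ`-saturation: every set of formulas in finitely many variables, with fewer than `κ`
parameters, that is finitely satisfiable in `M` is satisfied in `M`. -/
def IsSaturated (L : FirstOrder.Language.{u, v}) (M : Type m) [L.Structure M]
    (κ : Cardinal.{m}) : Prop :=
  ∀ (A : Set M), #A < κ → ∀ (l : ℕ) (Γ : Set (L.Formula (A ⊕ Fin l))),
    (∀ Γ₀ : Set (L.Formula (A ⊕ Fin l)), Γ₀ ⊆ Γ → Γ₀.Finite →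
      ∃ x : Fin l → M, ∀ φ ∈ Γ₀, φ.Realize (Sum.elim (fun a : A => (a : M)) x)) →
    ∃ x : Fin l → M, ∀ φ ∈ Γ, φ.Realize (Sum.elim (fun a : A => (a : M)) x)

/-- Strong `κ`-homogeneity: every partial elementary map with domain of size less than `κ` extends
to an automorphism. -/
def IsStronglyHomogeneous (L : FirstOrder.Language.{u, v}) (M : Type m) [L.Structure M]
    (κ : Cardinal.{m}) : Prop :=
  ∀ (A : Set M), #A < κ → ∀ f : A → M,
    (∀ φ : L.Formula A, φ.Realize f ↔ φ.Realize (fun a : A => (a : M))) →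
    ∃ g : M ≃[L] M, ∀ a : A, g a = f a

/-- `M` is a monster model of `T` with respect to `κ`: a `κ`-saturated and strongly `κ`-homogeneous
model, where `κ` is a strong limit cardinal greater than `|T| = ℵ₀ + |L|`. -/
structure IsMonster {L : FirstOrder.Language.{u, v}} (T : L.Theory)
    (M : FirstOrder.Language.Theory.ModelType.{u, v, m} T) (κ : Cardinal.{m}) : Prop where
  strongLimit : κ.IsStrongLimit
  card_lt : Cardinal.lift.{m} (max ℵ₀ L.card) < Cardinal.lift.{max u v} κ
  saturated : IsSaturated L M κ
  homogeneous : IsStronglyHomogeneous L M κ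

end ClassicalLogic

/-! ## Generalized indiscernibles and the modeling properties

The index structures `I`, `J` are first-order `L'`-structures; the members of the sequences are
`k`-tuples of elements (`k = 1` gives sequences of elements). -/

/-- Equality of quantifier-free types of two tuples of the same finite length, taken from
`L'`-structures `I` and `J`. -/
def SameQFType (L' : FirstOrder.Language.{u', v'}) {I J : Type*} [L'.Structure I] [L'.Structure J]
    {n : ℕ} (i : Fin n → I) (j : Fin n → J) : Prop :=
  ∀ φ : L'.Formula (Fin n), φ.IsQF → (φ.Realize i ↔ φ.Realize j)

/-- For a sequence `a = (a_i : i ∈ I)` of `k`-tuples, the tuple `(a_{i_1}, …, a_{i_n})`. -/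
def subtuple {M : Type m} {I : Type*} {k n : ℕ} (a : I → Fin k → M) (i : Fin n → I) :
    Fin n × Fin k → M :=
  fun p => a (i p.1) p.2

namespace ClassicalLogic

/-- `I`-indexed indiscernible sequences (over `∅`). -/
def IsIndiscernible (L' : FirstOrder.Language.{u', v'}) {I : Type w} [L'.Structure I]
    (L : FirstOrder.Language.{u, v}) {M : Type m} [L.Structure M] {k : ℕ}
    (a : I → Fin k → M) : Prop :=
  ∀ (n : ℕ) (i j : Fin n → I), SameQFType L' i j →
    ∀ φ : L.Formula (Fin n × Fin k), φ.Realize (subtuple a i) ↔ φ.Realize (subtuple a j)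

/-- The sequence `b = (b_j : j ∈ J)` is locally based on `a = (a_i : i ∈ I)`. -/
def LocallyBased (L' : FirstOrder.Language.{u', v'}) {I J : Type*} [L'.Structure I] [L'.Structure J]
    (L : FirstOrder.Language.{u, v}) {M : Type m} [L.Structure M] {k : ℕ}
    (b : J → Fin k → M) (a : I → Fin k → M) : Prop :=
  ∀ (n : ℕ) (Δ : Set (L.Formula (Fin n × Fin k))), Δ.Finite → ∀ j : Fin n → J,
    ∃ i : Fin n → I, SameQFType L' i j ∧
      ∀ φ ∈ Δ, φ.Realize (subtuple b j) ↔ φ.Realize (subtuple a i)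

/-- `I`-indexed indiscernibles have the (classical) modeling property in `T`, for sequences of
`k`-tuples: for any `I`-indexed sequence in a monster model (with `I` small), there is an
`I`-indiscernible sequence in it that is locally based on the given one. -/
def ModelingProperty (L' : FirstOrder.Language.{u', v'}) (I : Type w) [L'.Structure I]
    {L : FirstOrder.Language.{u, v}} (T : L.Theory) (k : ℕ) : Prop :=
  ∀ (M : FirstOrder.Language.Theory.ModelType.{u, v, m} T) (κ : Cardinal.{m}),
    IsMonster T M κ → Cardinal.lift.{m} #I < Cardinal.lift.{w} κ →
    ∀ a : I → Fin k → M, ∃ b : I → Fin k → M, IsIndiscernible L' L b ∧ LocallyBased L' L b a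

end ClassicalLogic

namespace ContLogic

/-- `I`-indexed indiscernible sequences (over `∅`) in a metric structure. -/
def IsIndiscernible (L' : FirstOrder.Language.{u', v'}) {I : Type w} [L'.Structure I]
    {S : Signature.{u, v}} (N : MetricStructure.{u, v, m} S) {k : ℕ} (a : I → Fin k → N) : Prop :=
  ∀ (n : ℕ) (i j : Fin n → I), SameQFType L' i j →
    ∀ φ : Formula S (Fin n × Fin k), eval N φ (subtuple a i) = eval N φ (subtuple a j)

/-- The sequence `b = (b_j : j ∈ J)` is locally based on `a = (a_i : i ∈ I)`, in the continuous
sense. -/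
def LocallyBased (L' : FirstOrder.Language.{u', v'}) {I J : Type*} [L'.Structure I] [L'.Structure J]
    {S : Signature.{u, v}} (N : MetricStructure.{u, v, m} S) {k : ℕ}
    (b : J → Fin k → N) (a : I → Fin k → N) : Prop :=
  ∀ (n : ℕ) (Δ : Set (Formula S (Fin n × Fin k))), Δ.Finite → ∀ (j : Fin n → J) (ε : ℝ), 0 < ε →
    ∃ i : Fin n → I, SameQFType L' i j ∧
      ∀ φ ∈ Δ, |(eval N φ (subtuple b j) : ℝ) - (eval N φ (subtuple a i) : ℝ)| ≤ ε

/-- `I`-indexed indiscernibles have the continuous modeling property in `T`, for sequences of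
`k`-tuples. -/
def ModelingProperty (L' : FirstOrder.Language.{u', v'}) (I : Type w) [L'.Structure I]
    {S : Signature.{u, v}} (T : Theory S) (k : ℕ) : Prop :=
  ∀ (N : MetricStructure.{u, v, m} S) (κ : Cardinal.{m}),
    IsMonster N T κ → Cardinal.lift.{m} #I < Cardinal.lift.{w} κ →
    ∀ a : I → Fin k → N, ∃ b : I → Fin k → N, IsIndiscernible L' N b ∧ LocallyBased L' N b a

/-! ## First-order structures as metric structures -/

/-- The modulus with constant value `1`, which imposes no restriction on functions on a space all
of whose nonzero distances are `1`. -/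
def Modulus.one : Modulus := ⟨fun _ => 1, fun _ _ => one_pos⟩

/-- A first-order language as a continuous signature, with the same symbols. -/
def ofLanguage (L : FirstOrder.Language.{u, v}) : Signature.{u, v} where
  toLanguage := L
  funModulus _ _ := Modulus.one
  predModulus _ _ := Modulus.one

open Classical in
/-- The discrete metric, with all nonzero distances equal to `1`. -/
@[reducible] noncomputable def discreteMetric (M : Type m) : MetricSpace M where
  dist x y := if x = y then 0 else 1
  dist_self x := by simp
  dist_comm x y := by simp [eq_comm]
  dist_triangle x y z := by
    by_cases h₁ : x = y <;> by_cases h₂ : y = z <;> by_cases h₃ : x = z <;> simp_all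
  eq_of_dist_eq_zero {x y} h := by
    by_contra hne
    simp [hne] at h

open Classical in
theorem discreteMetric_dist_lt {M : Type m} {x y : M} (h : (discreteMetric M).dist x y < 1) :
    x = y := by
  by_contra hne
  have h' : (if x = y then (0 : ℝ) else 1) < 1 := h
  simp [hne] at h'

open Classical in
/-- A (nonempty) first-order structure as a metric structure: the metric is discrete, and
predicates take the value `0` where they are true and `1` where they are false. -/
noncomputable def ofStructure (L : FirstOrder.Language.{u, v}) (M : Type m) [L.Structure M]
    [Nonempty M] : MetricStructure.{u, v, m} (ofLanguage L) :=
  letI := discreteMetric M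
  { Carrier := M
    metric := discreteMetric M
    complete := by
      refine Metric.complete_of_cauchySeq_tendsto fun s hs => ?_
      obtain ⟨K, hK⟩ := Metric.cauchySeq_iff'.1 hs 1 one_pos
      refine ⟨s K, tendsto_const_nhds.congr' ?_⟩
      filter_upwards [Filter.eventually_ge_atTop K] with n hn
      exact (discreteMetric_dist_lt (hK n hn)).symm
    nonempty := inferInstance
    dist_le_one := fun x y => by
      change (if x = y then (0 : ℝ) else 1) ≤ 1
      split_ifs <;> norm_num
    funMap := fun {n} f x => FirstOrder.Language.Structure.funMap (L := L) (n := n) f x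
    predMap := fun {n} P x =>
      if FirstOrder.Language.Structure.RelMap (L := L) (n := n) P x then 0 else 1
    fun_unif := fun f i ε hε x y h => by
      have hxy : x i = y := discreteMetric_dist_lt h
      subst hxy
      rw [Function.update_eq_self]
      exact (dist_self _).trans_le hε.le
    pred_unif := fun P i ε hε x y h => by
      have hxy : x i = y := discreteMetric_dist_lt h
      subst hxy
      rw [Function.update_eq_self, sub_self, abs_zero]
      exact hε.le }

/-- `T'` is a continuous logic counterpart of the first-order theory `T`: they have the same
models, that is, the metric structures that are models of `T'` are exactly the models of `T`,
viewed as metric structures. -/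
def IsCounterpart {L : FirstOrder.Language.{u, v}} (T : L.Theory) (T' : Theory (ofLanguage L)) :
    Prop :=
  ∀ N : MetricStructure.{u, v, m} (ofLanguage L), Models N T' ↔
    ∃ M : FirstOrder.Language.Theory.ModelType.{u, v, m} T, N = ofStructure L M

end ContLogic

/-!
A first-order structure `M`, viewed as a metric structure, has the same expressive power in
continuous logic as in classical logic, and this is uniform in `M`.

* A first-order formula `φ` is expressed by the continuous formula `ofBoundedFormula φ`, which takes
  the value `0` where `φ` holds and `1` where it fails.
* Conversely, the value of a continuous formula is a function of the truth values of *finitely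
  many* first-order formulas (`exists_bEval_eq`). This goes by induction on the formula. For `sup`
  and `inf` the point is that the supremum of `F (p z)` over all `z` depends only on the set of
  those finitely many truth assignments `p` that are realized by some `z`, and membership of a given
  `p` in this set is a first-order condition.

Hence two tuples agree on all continuous formulas iff they agree on all first-order ones, the
condition `φ = 0` is first-order expressible, and agreement on a finite set of continuous formulas
follows from agreement on a finite set of first-order formulas. So saturation, homogeneity,
indiscernibility and local basedness have the same meaning in `M` and in its metric version. As the
models of a counterpart `T'` are exactly the models of `T` in their metric versions, the two
modeling properties quantify over the same data.
-/

namespace ContLogic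

variable {L : FirstOrder.Language.{u, v}} {M : Type m} [L.Structure M] [Nonempty M] {α : Type w}

/-! ### Translating formulas between classical and continuous logic -/

theorem termEval_ofStructure {β : Type w} (x : β → M) (t : L.Term β) :
    termEval (ofStructure L M) x t = t.realize x := by
  induction t with
  | var b => rfl
  | func f ts ih =>
    exact congrArg (FirstOrder.Language.Structure.funMap (M := M) f) (funext ih)

open Classical in
theorem bEval_dist_ofStructure {n : ℕ} (t₁ t₂ : L.Term (α ⊕ Fin n)) (x : α → M) (y : Fin n → M) :
    bEval (ofStructure L M) (.dist t₁ t₂ : BFormula (ofLanguage L) α n) x y =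
      if (t₁.bdEqual t₂).Realize x y then 0 else 1 := by
  have h : ((bEval (ofStructure L M) (.dist t₁ t₂ : BFormula (ofLanguage L) α n) x y :
      unitInterval) : ℝ) =
      if t₁.realize (Sum.elim x y) = t₂.realize (Sum.elim x y) then 0 else 1 :=
    congrArg₂ (fun a b : M => if a = b then (0 : ℝ) else 1)
      (termEval_ofStructure (Sum.elim x y) t₁) (termEval_ofStructure (Sum.elim x y) t₂)
  refine Subtype.ext (h.trans ?_)
  rw [FirstOrder.Language.BoundedFormula.realize_bdEqual]
  split_ifs <;> rfl

open Classical in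
theorem bEval_pred_ofStructure {n l : ℕ} (P : L.Relations l) (ts : Fin l → L.Term (α ⊕ Fin n))
    (x : α → M) (y : Fin n → M) :
    bEval (ofStructure L M) (.pred P ts : BFormula (ofLanguage L) α n) x y =
      if (P.boundedFormula ts).Realize x y then 0 else 1 := by
  rw [FirstOrder.Language.BoundedFormula.realize_rel]
  exact congrArg (fun a : Fin l → M =>
      if FirstOrder.Language.Structure.RelMap P a then (0 : unitInterval) else 1)
    (funext fun i => termEval_ofStructure (Sum.elim x y) (ts i))

/-- The connective `(a, b) ↦ min (1 - a) b`, which on truth values, `0` being true, is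
implication. -/
def impConn : C(Fin 2 → unitInterval, unitInterval) where
  toFun v := unitInterval.symm (v 0) ⊓ v 1
  continuous_toFun := by fun_prop

/-- A first-order formula as a `{0,1}`-valued continuous formula, with `0` standing for truth. -/
def ofBoundedFormula : ∀ {n : ℕ}, L.BoundedFormula α n → BFormula (ofLanguage L) α n
  | _, .falsum => .conn (l := 0) (.const _ 1) Fin.elim0
  | _, .equal t₁ t₂ => .dist t₁ t₂
  | _, .rel R ts => .pred R ts
  | _, .imp φ ψ => .conn impConn ![ofBoundedFormula φ, ofBoundedFormula ψ]
  | _, .all φ => .sup (ofBoundedFormula φ)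

open Classical in
theorem bEval_ofBoundedFormula {n : ℕ} (φ : L.BoundedFormula α n) (x : α → M) (y : Fin n → M) :
    bEval (ofStructure L M) (ofBoundedFormula φ) x y = if φ.Realize x y then 0 else 1 := by
  induction φ with
  | falsum => exact (if_neg id).symm
  | equal t₁ t₂ => exact bEval_dist_ofStructure t₁ t₂ x y
  | rel R ts => exact bEval_pred_ofStructure R ts x y
  | imp φ ψ ihφ ihψ =>
    change unitInterval.symm (bEval (ofStructure L M) (ofBoundedFormula φ) x y) ⊓
      bEval (ofStructure L M) (ofBoundedFormula ψ) x y = _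
    rw [ihφ, ihψ, FirstOrder.Language.BoundedFormula.realize_imp]
    by_cases h₁ : φ.Realize x y <;> by_cases h₂ : ψ.Realize x y <;> simp [h₁, h₂]
  | all φ ih =>
    refine (iSup_congr fun z : M => ih (Fin.snoc y z)).trans ?_
    simp only [FirstOrder.Language.BoundedFormula.realize_all]
    split_ifs with h
    · simp [h]
    · obtain ⟨z, hz⟩ := not_forall.1 h
      refine le_antisymm unitInterval.le_one' (le_iSup_of_le z ?_)
      rw [if_neg hz]

/-- The value of a continuous formula at a tuple of a discrete structure is a function of the truth
values of finitely many first-order formulas, uniformly in all structures. -/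
theorem exists_bEval_eq {n : ℕ} (φ : BFormula (ofLanguage L) α n) :
    ∃ (ι : Type) (_ : Finite ι) (ψ : ι → L.BoundedFormula α n) (F : (ι → Prop) → unitInterval),
      ∀ (M : Type m) [L.Structure M] [Nonempty M] (x : α → M) (y : Fin n → M),
        bEval (ofStructure L M) φ x y = F (fun i => (ψ i).Realize x y) := by
  classical
  -- The formula saying that the truth values of the `ψ i` are given by `p`, for some value of the
  -- last variable.
  have key : ∀ {n : ℕ} (ι : Type) [Finite ι] (ψ : ι → L.BoundedFormula α (n + 1)) (p : ι → Prop),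
      ∃ χ : L.BoundedFormula α n, ∀ (M : Type m) [L.Structure M] (x : α → M) (y : Fin n → M),
        χ.Realize x y ↔ ∃ z : M, (fun i => (ψ i).Realize x (Fin.snoc y z)) = p := by
    intro n ι _ ψ p
    refine ⟨(FirstOrder.Language.BoundedFormula.iInf
      fun i => if p i then ψ i else (ψ i).not).ex, fun M _ x y => ?_⟩
    simp only [FirstOrder.Language.BoundedFormula.realize_ex,
      FirstOrder.Language.BoundedFormula.realize_iInf]
    refine exists_congr fun z => ?_
    rw [funext_iff]
    refine forall_congr' fun i => ?_
    by_cases h : p i <;> simp [h]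
  induction φ with
  | dist t₁ t₂ =>
    exact ⟨Unit, inferInstance, fun _ => FirstOrder.Language.Term.bdEqual (L := L) t₁ t₂,
      fun p => if p () then 0 else 1,
      fun M _ _ x y => bEval_dist_ofStructure (L := L) t₁ t₂ x y⟩
  | pred P ts =>
    exact ⟨Unit, inferInstance, fun _ => FirstOrder.Language.Relations.boundedFormula (L := L) P ts,
      fun p => if p () then 0 else 1,
      fun M _ _ x y => bEval_pred_ofStructure (L := L) P ts x y⟩
  | conn c φs ih =>
    choose ι hι ψ F h using ih
    exact ⟨Σ i, ι i, inferInstance, fun s => ψ s.1 s.2, fun p => c fun i => F i fun j => p ⟨i, j⟩,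
      fun M _ _ x y => congrArg c (funext fun i => h i M x y)⟩
  | sup φ ih =>
    obtain ⟨ι, _, ψ, F, h⟩ := ih
    choose χ hχ using key ι ψ
    refine ⟨ι → Prop, inferInstance, χ, fun q => ⨆ (p : ι → Prop) (_ : q p), F p,
      fun M _ _ x y => ?_⟩
    refine (iSup_congr fun z : M => h M x (Fin.snoc y z)).trans ?_
    simp only [hχ]
    exact (iSup_range (g := F)
      (f := fun z : M => fun i => (ψ i).Realize x (Fin.snoc y z))).symm
  | inf φ ih =>
    obtain ⟨ι, _, ψ, F, h⟩ := ih
    choose χ hχ using key ι ψ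
    refine ⟨ι → Prop, inferInstance, χ, fun q => ⨅ (p : ι → Prop) (_ : q p), F p,
      fun M _ _ x y => ?_⟩
    refine (iInf_congr fun z : M => h M x (Fin.snoc y z)).trans ?_
    simp only [hχ]
    exact (iInf_range (g := F)
      (f := fun z : M => fun i => (ψ i).Realize x (Fin.snoc y z))).symm

theorem exists_eval_eq (φ : Formula (ofLanguage L) α) :
    ∃ (ι : Type) (_ : Finite ι) (ψ : ι → L.Formula α) (F : (ι → Prop) → unitInterval),
      ∀ (M : Type m) [L.Structure M] [Nonempty M] (x : α → M),
        eval (ofStructure L M) φ x = F (fun i => (ψ i).Realize x) := by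
  obtain ⟨ι, hι, ψ, F, h⟩ := exists_bEval_eq.{u, v, w, m} φ
  refine ⟨ι, hι, ψ, F, fun M _ _ x => (h M x Fin.elim0).trans ?_⟩
  simp only [FirstOrder.Language.Formula.Realize, Subsingleton.elim (default : Fin 0 → M) Fin.elim0]

/-- The condition `φ = 0` is first-order expressible over discrete structures. -/
theorem exists_realize_iff_eval_eq_zero (φ : Formula (ofLanguage L) α) :
    ∃ θ : L.Formula α, ∀ (M : Type m) [L.Structure M] [Nonempty M] (x : α → M),
      θ.Realize x ↔ eval (ofStructure L M) φ x = 0 := by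
  classical
  obtain ⟨ι, _, ψ, F, h⟩ := exists_eval_eq.{u, v, w, m} φ
  -- The disjunction, over the truth assignments that `F` sends to `0`, of their descriptions.
  refine ⟨FirstOrder.Language.BoundedFormula.iSup fun p : {p : ι → Prop // F p = 0} =>
    FirstOrder.Language.BoundedFormula.iInf
      fun i => if p.1 i then ψ i else (ψ i).not, fun M _ _ x => ?_⟩
  have hp : ∀ p : ι → Prop, (∀ i, (if p i then ψ i else (ψ i).not).Realize x) ↔
      (fun i => (ψ i).Realize x) = p := by
    intro p
    rw [funext_iff]
    refine forall_congr' fun i => ?_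
    by_cases hi : p i <;> simp [hi]
  rw [h, FirstOrder.Language.Formula.Realize, FirstOrder.Language.BoundedFormula.realize_iSup]
  simp only [FirstOrder.Language.BoundedFormula.realize_iInf]
  constructor
  · rintro ⟨⟨p, hF⟩, hr⟩
    rwa [(hp p).1 hr]
  · intro hF
    exact ⟨⟨_, hF⟩, (hp _).2 rfl⟩

/-- The case of `ofBoundedFormula` without variables reserved for quantification. -/
def ofFormula (φ : L.Formula α) : Formula (ofLanguage L) α := ofBoundedFormula φ

open Classical in
theorem eval_ofFormula (φ : L.Formula α) (x : α → M) :
    eval (ofStructure L M) (ofFormula φ) x = if φ.Realize x then 0 else 1 := by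
  rw [FirstOrder.Language.Formula.Realize, Subsingleton.elim (default : Fin 0 → M) Fin.elim0]
  exact bEval_ofBoundedFormula φ x Fin.elim0

theorem eval_ofFormula_eq_zero {φ : L.Formula α} {x : α → M} :
    eval (ofStructure L M) (ofFormula φ) x = 0 ↔ φ.Realize x := by
  rw [eval_ofFormula]
  split_ifs with h <;> simp [h]

/-- Values of `{0,1}`-valued formulas at distance less than `1` are equal. -/
theorem realize_iff_of_abs_eval_sub_le {φ : L.Formula α} {x y : α → M} {ε : ℝ} (hε : ε < 1)
    (h : |(eval (ofStructure L M) (ofFormula φ) x : ℝ) -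
      (eval (ofStructure L M) (ofFormula φ) y : ℝ)| ≤ ε) :
    φ.Realize x ↔ φ.Realize y := by
  classical
  replace h := h.trans_lt hε
  rw [eval_ofFormula, eval_ofFormula] at h
  by_cases hx : φ.Realize x <;> by_cases hy : φ.Realize y <;> simp_all

/-- Two tuples have the same continuous type iff they have the same classical type. -/
theorem forall_eval_eq_iff {x y : α → M} :
    (∀ φ : Formula (ofLanguage L) α,
        eval (ofStructure L M) φ x = eval (ofStructure L M) φ y) ↔
      ∀ φ : L.Formula α, φ.Realize x ↔ φ.Realize y := by
  refine ⟨fun h φ => ?_, fun h φ => ?_⟩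
  · rw [← eval_ofFormula_eq_zero, ← eval_ofFormula_eq_zero, h]
  · obtain ⟨ι, _, ψ, F, hF⟩ := exists_eval_eq.{u, v, _, m} φ
    simp only [hF, h]

/-! ### Monster models -/

theorem isSaturated_ofStructure_iff {κ : Cardinal.{m}} :
    IsSaturated (ofStructure L M) κ ↔ ClassicalLogic.IsSaturated L M κ := by
  constructor
  · intro h A hA l Γ hΓ
    obtain ⟨x, hx⟩ := h A hA l (ofFormula '' Γ) fun Γ₀ hsub hfin => by
      obtain ⟨Γ₁, hΓ₁, hfin₁, rfl⟩ := Set.exists_subset_image_finite_and.1 ⟨Γ₀, hsub, hfin, rfl⟩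
      obtain ⟨x, hx⟩ := hΓ Γ₁ hΓ₁ hfin₁
      exact ⟨x, Set.forall_mem_image.2 fun φ hφ => eval_ofFormula_eq_zero.2 (hx φ hφ)⟩
    exact ⟨x, fun φ hφ => eval_ofFormula_eq_zero.1 (hx _ (Set.mem_image_of_mem _ hφ))⟩
  · intro h A hA l Γ hΓ
    choose θ hθ using fun φ : Formula (ofLanguage L) (A ⊕ Fin l) =>
      exists_realize_iff_eval_eq_zero.{u, v, m, m} φ
    obtain ⟨x, hx⟩ := h A hA l (θ '' Γ) fun Γ₀ hsub hfin => by
      obtain ⟨Γ₁, hΓ₁, hfin₁, rfl⟩ := Set.exists_subset_image_finite_and.1 ⟨Γ₀, hsub, hfin, rfl⟩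
      obtain ⟨x, hx⟩ := hΓ Γ₁ hΓ₁ hfin₁
      exact ⟨x, Set.forall_mem_image.2 fun φ hφ => (hθ φ M _).2 (hx φ hφ)⟩
    exact ⟨x, fun φ hφ => (hθ φ M _).1 (hx _ (Set.mem_image_of_mem _ hφ))⟩

theorem exists_isAutomorphism_ofStructure_iff {A : Set M} {f : A → M} :
    (∃ g : M ≃ M, IsAutomorphism (ofStructure L M) g ∧ ∀ a : A, g a = f a) ↔
      ∃ g : M ≃[L] M, ∀ a : A, g a = f a := by
  classical
  constructor
  · rintro ⟨g, ⟨-, hfun, hpred⟩, hg⟩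
    refine ⟨{ g with
      map_fun' := fun F x => hfun _ F x
      map_rel' := fun R x => ?_ }, hg⟩
    have h : (if FirstOrder.Language.Structure.RelMap (M := M) R (g ∘ x)
        then (0 : unitInterval) else 1) =
      if FirstOrder.Language.Structure.RelMap (M := M) R x then 0 else 1 := hpred _ R x
    change FirstOrder.Language.Structure.RelMap (M := M) R (g ∘ x) ↔ _
    split_ifs at h <;> simp_all
  · rintro ⟨g, hg⟩
    have hdist : ∀ x y : M, (if g x = g y then (0 : ℝ) else 1) = if x = y then 0 else 1 :=
      fun x y => by simp only [g.injective.eq_iff]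
    have hpred : ∀ (n : ℕ) (R : L.Relations n) (x : Fin n → M),
        (if FirstOrder.Language.Structure.RelMap R (g ∘ x) then (0 : unitInterval) else 1) =
          if FirstOrder.Language.Structure.RelMap R x then 0 else 1 :=
      fun n R x => by simp only [g.map_rel]
    exact ⟨g.toEquiv, ⟨hdist, fun n F x => g.map_fun F x, hpred⟩, hg⟩

theorem isStronglyHomogeneous_ofStructure_iff {κ : Cardinal.{m}} :
    IsStronglyHomogeneous (ofStructure L M) κ ↔ ClassicalLogic.IsStronglyHomogeneous L M κ :=
  forall_congr' fun _ => forall_congr' fun _ => forall_congr' fun _ =>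
    imp_congr (forall_eval_eq_iff (M := M)) (exists_isAutomorphism_ofStructure_iff (M := M))

theorem IsCounterpart.isMonster_iff {T : L.Theory} {T' : Theory (ofLanguage L)}
    (hT' : IsCounterpart.{u, v, m} T T') (M : FirstOrder.Language.Theory.ModelType.{u, v, m} T)
    {κ : Cardinal.{m}} :
    IsMonster (ofStructure L M) T' κ ↔ ClassicalLogic.IsMonster T M κ :=
  ⟨fun h => ⟨h.strongLimit, h.card_lt, isSaturated_ofStructure_iff.1 h.saturated,
      isStronglyHomogeneous_ofStructure_iff.1 h.homogeneous⟩,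
    fun h => ⟨(hT' _).2 ⟨M, rfl⟩, h.strongLimit, h.card_lt,
      isSaturated_ofStructure_iff.2 h.saturated,
      isStronglyHomogeneous_ofStructure_iff.2 h.homogeneous⟩⟩

/-! ### Indiscernible sequences -/

variable {L' : FirstOrder.Language.{u', v'}} {I : Type w} [L'.Structure I] {k : ℕ}

theorem isIndiscernible_ofStructure_iff {a : I → Fin k → M} :
    IsIndiscernible L' (ofStructure L M) a ↔ ClassicalLogic.IsIndiscernible L' L a :=
  forall_congr' fun _ => forall_congr' fun _ => forall_congr' fun _ =>
    imp_congr Iff.rfl forall_eval_eq_iff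

theorem locallyBased_ofStructure_iff {a b : I → Fin k → M} :
    LocallyBased L' (ofStructure L M) b a ↔ ClassicalLogic.LocallyBased L' L b a := by
  constructor
  · intro h n Δ hΔ j
    obtain ⟨i, hi, hφ⟩ := h n (ofFormula '' Δ) (hΔ.image _) j (1 / 2) (by norm_num)
    exact ⟨i, hi, fun φ hmem => realize_iff_of_abs_eval_sub_le (by norm_num)
      (hφ _ (Set.mem_image_of_mem _ hmem))⟩
  · intro h n Δ hΔ j ε hε
    choose ι hι ψ F hF using fun φ : Formula (ofLanguage L) (Fin n × Fin k) =>
      exists_eval_eq.{u, v, 0, m} φ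
    obtain ⟨i, hi, hψ⟩ := h n (⋃ φ ∈ Δ, Set.range (ψ φ))
      (hΔ.biUnion fun φ _ => Set.finite_range _) j
    refine ⟨i, hi, fun φ hφ => ?_⟩
    have : eval (ofStructure L M) φ (subtuple b j) = eval (ofStructure L M) φ (subtuple a i) :=
      (hF φ M _).trans <| (congrArg (F φ) (funext fun s =>
        propext (hψ _ (Set.mem_biUnion hφ (Set.mem_range_self s))))).trans (hF φ M _).symm
    rw [this, sub_self, abs_zero]
    exact hε.le

end ContLogic

theorem mainTheorem8 {L : FirstOrder.Language.{u, v}} (T : L.Theory)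
    (T' : ContLogic.Theory (ContLogic.ofLanguage L)) (hT' : ContLogic.IsCounterpart.{u, v, m} T T')
    {L' : FirstOrder.Language.{u', v'}} (I : Type w) [L'.Structure I] (k : ℕ) :
    ContLogic.ModelingProperty.{u, v, u', v', w, m} L' I T' k ↔
      ClassicalLogic.ModelingProperty.{u, v, u', v', w, m} L' I T k := by
  constructor
  · intro h M κ hM hI a
    obtain ⟨b, hb, hba⟩ := h (ContLogic.ofStructure L M) κ ((hT'.isMonster_iff M).2 hM) hI a
    exact ⟨b, ContLogic.isIndiscernible_ofStructure_iff.1 hb,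
      ContLogic.locallyBased_ofStructure_iff.1 hba⟩
  · intro h N κ hN hI a
    obtain ⟨M, rfl⟩ := (hT' N).1 hN.models
    obtain ⟨b, hb, hba⟩ := h M κ ((hT'.isMonster_iff M).1 hN) hI a
    exact ⟨b, ContLogic.isIndiscernible_ofStructure_iff.2 hb,
      ContLogic.locallyBased_ofStructure_iff.2 hba⟩
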